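/- Conventions. Let $A$ be a domain with quotient field $K$. For a nonzero fractional ideal $\mathfrak a$ of $A$ put $\mathfrak a^{-1}=\{x\in K : x\mathfrak a\subseteq A\}$ and $\mathfrak a_v=(\mathfrak a^{-1})^{-1}$ (and $0_v=0$); $\mathfrak a$ is divisorial if $\mathfrak a=\mathfrak a_v$. The domain $A$ is a Krull domain if its divisorial ideals satisfy the ascending chain condition and $A$ is completely integrally closed, i.e. every $x\in K$ for which there is $c\in K\setminus\{0\}$ with $cx^m\in A$ for all $m\ge 0$ lies in $A$. For a Krull domain $A$, the nonzero divisorial fractional ideals form an abelian group under $\mathfrak a\cdot_v\mathfrak b=(\mathfrak a\mathfrak b)_v$, and the (divisor) class group $\mathcal C(A)$ is the quotient of this group by the subgroup of nonzero principal fractional ideals. Theorem. Let $A$ be a Krull domain, and let $x_1,\ldots,x_n\in A$ be elements such that the localization $A[x_1^{-1},\ldots,x_n^{-1}]=D[x_1^{\pm1},\ldots,x_n^{\pm1}]$ is a Laurent polynomial ring in the indeterminates $x_1,\ldots,x_n$ over some factorial subring $D\subseteq A$. Let $\mathfrak p_1,\ldots,\mathfrak p_t$ be the pairwise distinct height-$1$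 prime ideals of $A$ containing at least one of the elements $x_1,\ldots,x_n$. For each $i\in\{1,\ldots,n\}$ let $\mathbf a_i=(a_{i1},\ldots,a_{it})\in\mathbb Z_{\ge0}^t$ be such that $$x_iA=\Big(\prod_{j=1}^t\mathfrak p_j^{a_{ij}}\Big)_v .$$ Then $\mathcal C(A)\cong\mathbb Z^t/\langle \mathbf a_1,\ldots,\mathbf a_n\rangle$ as abelian groups, where $\langle\mathbf a_1,\ldots,\mathbf a_n\rangle$ is the subgroup of $\mathbb Z^t$ generated by $\mathbf a_1,\ldots,\mathbf a_n$. -/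

import Mathlib

open scoped nonZeroDivisors

noncomputable section

namespace FractionalIdeal

variable {A : Type*} [CommRing A] [IsDomain A] {K : Type*} [Field K] [Algebra A K]
  [IsFractionRing A K]

/-- The divisorial closure `I_v = (I⁻¹)⁻¹` of a fractional ideal `I` of a domain `A`, where
`I⁻¹ = (A : I) = {x ∈ K | x I ⊆ A}`. -/
def divisorialClosure (I : FractionalIdeal A⁰ K) : FractionalIdeal A⁰ K := (I⁻¹)⁻¹

/-- A fractional ideal is divisorial if it equals its divisorial closure. -/
def IsDivisorial (I : FractionalIdeal A⁰ K) : Prop := divisorialClosure I = I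

theorem le_inv_iff_mul_le_one {I J : FractionalIdeal A⁰ K} (hJ : J ≠ 0) :
    I ≤ J⁻¹ ↔ I * J ≤ 1 :=
  le_div_iff_mul_le hJ

theorem inv_ne_zero_of_ne_zero {I : FractionalIdeal A⁰ K} (hI : I ≠ 0) : I⁻¹ ≠ 0 := by
  obtain ⟨d, J, hd, hJ⟩ := exists_eq_spanSingleton_mul I
  have hd' : algebraMap A K d ≠ 0 := by
    simpa using hd
  have h : spanSingleton A⁰ (algebraMap A K d) ≤ I⁻¹ := by
    rw [le_inv_iff_mul_le_one hI, hJ, ← mul_assoc, spanSingleton_mul_spanSingleton,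
      mul_inv_cancel₀ hd', spanSingleton_one, one_mul]
    exact coeIdeal_le_one
  intro h0
  rw [h0, le_zero_iff, spanSingleton_eq_zero_iff] at h
  exact hd' h

theorem mul_ne_zero_of_ne_zero {I J : FractionalIdeal A⁰ K} (hI : I ≠ 0) (hJ : J ≠ 0) :
    I * J ≠ 0 := by
  obtain ⟨b, hb, hb0⟩ : ∃ b ∈ I, b ≠ 0 := by
    by_contra! h
    exact hI (eq_zero_iff.2 h)
  obtain ⟨c, hc, hc0⟩ : ∃ c ∈ J, c ≠ 0 := by
    by_contra! h
    exact hJ (eq_zero_iff.2 h)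
  exact fun h => mul_ne_zero hb0 hc0 (eq_zero_iff.1 h _ (mul_mem_mul hb hc))

theorem le_divisorialClosure {I : FractionalIdeal A⁰ K} (hI : I ≠ 0) :
    I ≤ divisorialClosure I := by
  rw [divisorialClosure, le_inv_iff_mul_le_one (inv_ne_zero_of_ne_zero hI)]
  exact mul_one_div_le_one

theorem divisorialClosure_ne_zero {I : FractionalIdeal A⁰ K} (hI : I ≠ 0) :
    divisorialClosure I ≠ 0 :=
  inv_ne_zero_of_ne_zero (inv_ne_zero_of_ne_zero hI)

theorem isDivisorial_inv {I : FractionalIdeal A⁰ K} (hI : I ≠ 0) : IsDivisorial I⁻¹ := by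
  refine le_antisymm ?_ (le_divisorialClosure (inv_ne_zero_of_ne_zero hI))
  exact inv_anti_mono hI (divisorialClosure_ne_zero hI) (le_divisorialClosure hI)

theorem isDivisorial_divisorialClosure {I : FractionalIdeal A⁰ K} (hI : I ≠ 0) :
    IsDivisorial (divisorialClosure I) :=
  isDivisorial_inv (inv_ne_zero_of_ne_zero hI)

theorem isDivisorial_spanSingleton (x : K) : IsDivisorial (spanSingleton A⁰ x) := by
  simp [IsDivisorial, divisorialClosure]

theorem divisorialClosure_mul_left {I J : FractionalIdeal A⁰ K} (hI : I ≠ 0) (hJ : J ≠ 0) :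
    divisorialClosure (divisorialClosure I * J) = divisorialClosure (I * J) := by
  have h : (divisorialClosure I * J)⁻¹ = (I * J)⁻¹ := by
    refine le_antisymm (inv_anti_mono (mul_ne_zero_of_ne_zero hI hJ)
      (mul_ne_zero_of_ne_zero (divisorialClosure_ne_zero hI) hJ)
      (mul_le_mul_left (le_divisorialClosure hI) J)) ?_
    rw [le_inv_iff_mul_le_one (mul_ne_zero_of_ne_zero (divisorialClosure_ne_zero hI) hJ),
      mul_comm (divisorialClosure I), ← mul_assoc,
      ← le_inv_iff_mul_le_one (divisorialClosure_ne_zero hI)]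
    rw [show (divisorialClosure I)⁻¹ = I⁻¹ from isDivisorial_inv hI,
      le_inv_iff_mul_le_one hI, mul_assoc, mul_comm J I]
    exact (le_inv_iff_mul_le_one (mul_ne_zero_of_ne_zero hI hJ)).1 le_rfl
  rw [divisorialClosure, h, divisorialClosure]

end FractionalIdeal

open FractionalIdeal

/-- A Krull domain: a domain that is `v`-noetherian (the divisorial ideals satisfy the ascending
chain condition) and completely integrally closed (every almost integral element of the quotient
field lies in the domain). -/
class IsKrullDomain (A : Type*) [CommRing A] [IsDomain A] : Prop where
  wellFoundedGT_divisorial : WellFoundedGT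
    {I : Ideal A // IsDivisorial (I : FractionalIdeal A⁰ (FractionRing A))}
  mem_range_of_isAlmostIntegral : ∀ x : FractionRing A, IsAlmostIntegral A x →
    x ∈ (algebraMap A (FractionRing A)).range

/-- In a completely integrally closed domain, `(I I⁻¹)_v = A` for every nonzero `I`. -/
theorem divisorialClosure_inv_mul_self {A : Type*} [CommRing A] [IsDomain A] [IsKrullDomain A]
    {I : FractionalIdeal A⁰ (FractionRing A)} (hI : I ≠ 0) :
    divisorialClosure (I⁻¹ * I) = 1 := by
  have hI' := inv_ne_zero_of_ne_zero hI
  have hII := mul_ne_zero_of_ne_zero hI' hI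
  suffices h : (I⁻¹ * I)⁻¹ = 1 by
    rw [divisorialClosure, h, ← spanSingleton_one, spanSingleton_inv, inv_one]
  refine le_antisymm (fun x hx => ?_) ?_
  · have hx1 : spanSingleton A⁰ x * I⁻¹ ≤ I⁻¹ := by
      rw [le_inv_iff_mul_le_one hI, mul_assoc, ← le_inv_iff_mul_le_one hII]
      exact spanSingleton_le_iff_mem.2 hx
    have hmul : ∀ y ∈ I⁻¹, x * y ∈ I⁻¹ := fun y hy =>
      hx1 (mul_mem_mul (mem_spanSingleton_self A⁰ x) hy)
    obtain ⟨c, hc, hc0⟩ : ∃ c ∈ I⁻¹, c ≠ 0 := by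
      by_contra! h
      exact hI' (eq_zero_iff.2 h)
    obtain ⟨b, hb, hb0⟩ : ∃ b ∈ I, b ≠ 0 := by
      by_contra! h
      exact hI (eq_zero_iff.2 h)
    have hpow : ∀ n : ℕ, x ^ n * c ∈ I⁻¹ := by
      intro n
      induction n with
      | zero => simpa using hc
      | succ k ih =>
        rw [pow_succ', mul_assoc]
        exact hmul _ ih
    have hA : ∀ n : ℕ, x ^ n * c * b ∈ (1 : FractionalIdeal A⁰ (FractionRing A)) := fun n =>
      (mem_inv_iff hI).1 (hpow n) b hb
    obtain ⟨r, hr⟩ := (mem_one_iff A⁰).1 (hA 0)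
    rw [pow_zero, one_mul] at hr
    have hr0 : r ≠ 0 := by
      rintro rfl
      rw [map_zero] at hr
      exact mul_ne_zero hc0 hb0 hr.symm
    have hint : IsAlmostIntegral A x := by
      refine ⟨r, mem_nonZeroDivisors_of_ne_zero hr0, fun n => ?_⟩
      obtain ⟨s, hs⟩ := (mem_one_iff A⁰).1 (hA n)
      refine ⟨s, ?_⟩
      rw [hs, Algebra.smul_def, hr]
      ring
    obtain ⟨s, hs⟩ := IsKrullDomain.mem_range_of_isAlmostIntegral x hint
    exact (mem_one_iff A⁰).2 ⟨s, hs⟩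
  · rw [le_inv_iff_mul_le_one hII, one_mul, mul_comm]
    exact mul_one_div_le_one

/-- The nonzero divisorial fractional ideals of a domain `A`. -/
@[ext]
structure DivisorialFractionalIdeal (A : Type*) [CommRing A] [IsDomain A] where
  /-- The underlying fractional ideal. -/
  val : FractionalIdeal A⁰ (FractionRing A)
  ne_zero : val ≠ 0
  isDivisorial : IsDivisorial val

namespace DivisorialFractionalIdeal

variable {A : Type*} [CommRing A] [IsDomain A]

/-- The divisorial product `I ·_v J = (I J)_v`. -/
instance : Mul (DivisorialFractionalIdeal A) where
  mul I J := ⟨divisorialClosure (I.val * J.val),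
    divisorialClosure_ne_zero (mul_ne_zero_of_ne_zero I.ne_zero J.ne_zero),
    isDivisorial_divisorialClosure (mul_ne_zero_of_ne_zero I.ne_zero J.ne_zero)⟩

instance : One (DivisorialFractionalIdeal A) where
  one := ⟨1, one_ne_zero, by
    rw [← spanSingleton_one]
    exact isDivisorial_spanSingleton 1⟩

instance : Inv (DivisorialFractionalIdeal A) where
  inv I := ⟨I.val⁻¹, inv_ne_zero_of_ne_zero I.ne_zero, isDivisorial_inv I.ne_zero⟩

theorem val_mul (I J : DivisorialFractionalIdeal A) :
    (I * J).val = divisorialClosure (I.val * J.val) := rfl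

theorem val_one : (1 : DivisorialFractionalIdeal A).val = 1 := rfl

theorem val_inv (I : DivisorialFractionalIdeal A) : (I⁻¹).val = I.val⁻¹ := rfl

/-- The nonzero divisorial fractional ideals of a Krull domain form a group under the divisorial
product. -/
instance [IsKrullDomain A] : CommGroup (DivisorialFractionalIdeal A) where
  mul_assoc I J L := by
    refine DivisorialFractionalIdeal.ext ?_
    simp only [val_mul]
    rw [divisorialClosure_mul_left (mul_ne_zero_of_ne_zero I.ne_zero J.ne_zero) L.ne_zero,
      mul_comm I.val (divisorialClosure _),
      divisorialClosure_mul_left (mul_ne_zero_of_ne_zero J.ne_zero L.ne_zero) I.ne_zero,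
      mul_comm _ I.val, mul_assoc]
  one_mul I := by
    refine DivisorialFractionalIdeal.ext ?_
    rw [val_mul, val_one, one_mul]
    exact I.isDivisorial
  mul_one I := by
    refine DivisorialFractionalIdeal.ext ?_
    rw [val_mul, val_one, mul_one]
    exact I.isDivisorial
  mul_comm I J := by
    refine DivisorialFractionalIdeal.ext ?_
    rw [val_mul, val_mul, mul_comm]
  inv_mul_cancel I := by
    refine DivisorialFractionalIdeal.ext ?_
    rw [val_mul, val_inv, val_one]
    exact divisorialClosure_inv_mul_self I.ne_zero

/-- The principal fractional ideal `x A`, for a nonzero element `x` of the quotient field. -/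
def principal (A : Type*) [CommRing A] [IsDomain A] [IsKrullDomain A] :
    (FractionRing A)ˣ →* DivisorialFractionalIdeal A where
  toFun x := ⟨spanSingleton A⁰ (x : FractionRing A), spanSingleton_ne_zero_iff.2 x.ne_zero,
    isDivisorial_spanSingleton _⟩
  map_one' := DivisorialFractionalIdeal.ext (by simp [val_one])
  map_mul' x y := by
    refine DivisorialFractionalIdeal.ext ?_
    rw [val_mul]
    simp only
    rw [spanSingleton_mul_spanSingleton, isDivisorial_spanSingleton]
    simp only [Units.val_mul]

end DivisorialFractionalIdeal

/-- The divisor class group `C(A)` of a Krull domain `A`: nonzero divisorial fractional ideals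
modulo nonzero principal fractional ideals (written multiplicatively). -/
abbrev DivisorClassGroup (A : Type*) [CommRing A] [IsDomain A] [IsKrullDomain A] : Type _ :=
  DivisorialFractionalIdeal A ⧸ (DivisorialFractionalIdeal.principal A).range

/-- The localization `A[x₁⁻¹, …, xₙ⁻¹]` is the Laurent polynomial ring `D[x₁^{±1}, …, xₙ^{±1}]`
in the indeterminates `x₁, …, xₙ` over the subring `D` of `A`: there is a ring isomorphism from
the Laurent polynomial ring over `D` in `n` indeterminates (the group algebra `D[ℤⁿ]`) to the
localization that restricts to the inclusion on `D` and maps the `i`-th indeterminate to `xᵢ`. -/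
def IsLaurentLocalization {A : Type*} [CommRing A] (D : Subring A) {n : ℕ} (x : Fin n → A) :
    Prop :=
  ∃ e : AddMonoidAlgebra D (Fin n → ℤ) ≃+* Localization (Submonoid.closure (Set.range x)),
    (∀ d : D, e (AddMonoidAlgebra.single 0 d) = algebraMap A _ (d : A)) ∧
    ∀ i, e (AddMonoidAlgebra.single (Pi.single i 1) 1) = algebraMap A _ (x i)

end

/-! Order the group of divisors by inclusion. The integral divisors are those ≤ 1, and the chain
condition makes each a product of elements covered by 1 (`mem_closure_covBy_one`). These elements
are exactly the height-one primes.

Let S be the monoid generated by the `x i`, and send m ∈ ℤ^t to the class of ∏ p_j^{m_j}.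
Surjectivity is Nagata's theorem (`eq_top_of_uniqueFactorizationMonoid_localization`): S⁻¹A is a
Laurent ring over a factorial ring, hence factorial, so a height-one prime Q disjoint from S
contains some π that is prime in S⁻¹A. Then (π) = Q·J where every prime factor of J meets S, i.e. is
one of the p_j.

For the kernel, if ∏ p_j^{m_j} = (f), then f is a unit of S⁻¹A (`principal_mem_of_eq_prod`). Units
of a Laurent ring over a domain are units of the base times monomials
(`exists_eq_single_of_isUnit`), so (f) is a product of powers of the (x_i). The p_j are independent
in the divisor group (`divisorOf_injective`), so m is an integer combination of the a_i. -/

open FractionalIdeal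

/-! ### Laurent polynomial rings: units and factoriality. -/

namespace AddMonoidAlgebra

section Units

variable {R M : Type*} [CommRing R] [IsDomain R] [AddCommGroup M] [TwoUniqueSums M]

/-- The units of the group algebra of a group with two unique sums over a domain are trivial. -/
theorem exists_eq_single_of_isUnit {f : AddMonoidAlgebra R M} (hf : IsUnit f) :
    ∃ (m : M) (r : R), IsUnit r ∧ f = single m r := by
  classical
  obtain ⟨g, hfg⟩ := hf.exists_right_inv
  have hf0 : f ≠ 0 := hf.ne_zero
  have hg0 : g ≠ 0 := by rintro rfl; simp at hfg
  -- Otherwise there are two distinct pairs of exponents with unique sums. Each sum has a nonzero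
  -- coefficient in f * g = 1, so both sums are 0, against uniqueness.
  have hle : ¬ 1 < f.coeff.support.card * g.coeff.support.card := by
    intro h
    obtain ⟨p, hp, q, hq, hpq, up, uq⟩ := TwoUniqueSums.uniqueAdd_of_one_lt_card h
    have key : ∀ r ∈ f.coeff.support ×ˢ g.coeff.support,
        UniqueAdd f.coeff.support g.coeff.support r.1 r.2 → r.1 + r.2 = 0 := by
      intro r hr ur
      have h1 := coeff_mul_add_of_uniqueAdd ur
      rw [hfg] at h1
      by_contra h0
      rw [Finset.mem_product, Finsupp.mem_support_iff, Finsupp.mem_support_iff] at hr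
      refine mul_ne_zero hr.1 hr.2 (h1.symm.trans ?_)
      rw [one_def, coeff_single, Finsupp.single_apply, if_neg (Ne.symm h0)]
    have hp' := Finset.mem_product.1 hp
    have := uq hp'.1 hp'.2 ((key p hp up).trans (key q hq uq).symm)
    exact hpq (Prod.ext this.1 this.2)
  have hfc : f.coeff.support.card ≠ 0 := by simpa using hf0
  have hgc : g.coeff.support.card ≠ 0 := by simpa using hg0
  have h1 : f.coeff.support.card = 1 ∧ g.coeff.support.card = 1 := by
    have := Nat.pos_of_ne_zero hfc
    have := Nat.pos_of_ne_zero hgc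
    exact mul_eq_one.1 (le_antisymm (not_lt.1 hle) (Nat.mul_pos ‹_› ‹_›))
  obtain ⟨m, r, -, hm⟩ := Finsupp.card_support_eq_one'.1 h1.1
  obtain ⟨m', r', -, hm'⟩ := Finsupp.card_support_eq_one'.1 h1.2
  have e1 : f = single m r := coeff_injective hm
  have e2 : g = single m' r' := coeff_injective hm'
  refine ⟨m, r, ?_, e1⟩
  rw [e1, e2, single_mul_single, one_def] at hfg
  have h2 := congrArg (fun x => x.coeff 0) hfg
  simp only [coeff_single] at h2
  rw [Finsupp.single_eq_same, Finsupp.single_apply] at h2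
  split_ifs at h2 with h3
  · exact IsUnit.of_mul_eq_one _ h2
  · exact absurd h2 zero_ne_one

end Units

section UFD

variable (R ι : Type*) [CommRing R]

/-- The inclusion of exponents `ℕ^ι → ℤ^ι`. -/
noncomputable def exponentInclusion : (ι →₀ ℕ) →+ (ι → ℤ) where
  toFun m i := m i
  map_zero' := by ext; simp
  map_add' _ _ := by ext; simp

theorem exponentInclusion_injective : Function.Injective (exponentInclusion ι) := by
  intro a b h
  ext i
  exact Int.ofNat.inj (congrFun h i)

/-- The inclusion of the polynomial ring into the Laurent polynomial ring. -/
noncomputable def ofMvPolynomial : MvPolynomial ι R →+* AddMonoidAlgebra R (ι → ℤ) :=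
  mapDomainRingHom R (exponentInclusion ι)

theorem ofMvPolynomial_single (m : ι →₀ ℕ) (r : R) :
    ofMvPolynomial R ι (single m r) = single (exponentInclusion ι m) r :=
  mapDomain_single

theorem ofMvPolynomial_injective : Function.Injective (ofMvPolynomial R ι) :=
  mapDomain_injective (exponentInclusion_injective ι)

/-- The submonoid of monomials with coefficient one. -/
noncomputable def monomials : Submonoid (MvPolynomial ι R) :=
  MonoidHom.mrange (of R (ι →₀ ℕ))

theorem single_mem_monomials (m : ι →₀ ℕ) :
    (single m 1 : MvPolynomial ι R) ∈ monomials R ι :=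
  ⟨Multiplicative.ofAdd m, rfl⟩

/-- A Laurent polynomial has finitely many terms, so one monomial clears all its negative exponents.
-/
theorem isLocalization_ofMvPolynomial [Finite ι] :
    letI := (ofMvPolynomial R ι).toAlgebra
    IsLocalization (monomials R ι) (AddMonoidAlgebra R (ι → ℤ)) := by
  let := (ofMvPolynomial R ι).toAlgebra
  have hal : ∀ f, algebraMap (MvPolynomial ι R) (AddMonoidAlgebra R (ι → ℤ)) f =
    ofMvPolynomial R ι f := fun _ => rfl
  refine ⟨?_, ?_, ?_⟩
  · rintro ⟨_, m, rfl⟩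
    change IsUnit (ofMvPolynomial R ι (single m.toAdd 1))
    rw [ofMvPolynomial_single]
    refine IsUnit.of_mul_eq_one (single (-exponentInclusion ι m.toAdd) 1) ?_
    rw [single_mul_single, add_neg_cancel, mul_one, one_def]
  · have key : ∀ f : AddMonoidAlgebra R (ι → ℤ), ∃ (k : ι →₀ ℕ) (g : MvPolynomial ι R),
        f * single (exponentInclusion ι k) 1 = ofMvPolynomial R ι g := by
      intro f
      induction f using induction_linear with
      | zero => exact ⟨0, 0, by simp⟩
      | add f g hf hg =>
        obtain ⟨k, u, hu⟩ := hf
        obtain ⟨l, v, hv⟩ := hg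
        refine ⟨k + l, u * single l 1 + v * single k 1, ?_⟩
        have hkl : (single (exponentInclusion ι (k + l)) 1 : AddMonoidAlgebra R (ι → ℤ)) =
            single (exponentInclusion ι k) 1 * single (exponentInclusion ι l) 1 := by
          rw [single_mul_single, map_add, mul_one]
        rw [hkl, map_add (ofMvPolynomial R ι), map_mul, map_mul, ofMvPolynomial_single, ofMvPolynomial_single, ← hu, ← hv]
        ring
      | single m r =>
        -- Multiplying by the negative part of m leaves its positive part.
        refine ⟨Finsupp.equivFunOnFinite.symm fun i => (-m i).toNat,
          single (Finsupp.equivFunOnFinite.symm fun i => (m i).toNat) r, ?_⟩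
        rw [ofMvPolynomial_single, single_mul_single, mul_one]
        congr 1
        ext i
        simp only [exponentInclusion, AddMonoidHom.coe_mk, ZeroHom.coe_mk, Pi.add_apply,
          Finsupp.equivFunOnFinite_symm_apply_apply]
        omega
    intro f
    obtain ⟨k, g, h⟩ := key f
    refine ⟨(g, ⟨_, single_mem_monomials R ι k⟩), ?_⟩
    rw [hal, hal, ofMvPolynomial_single]
    exact h
  · intro f g h
    exact ⟨1, by rw [ofMvPolynomial_injective R ι h]⟩

/-- Laurent polynomial rings over factorial domains are factorial. -/
theorem uniqueFactorizationMonoid_laurent [Finite ι] [IsDomain R] [UniqueFactorizationMonoid R] :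
    UniqueFactorizationMonoid (AddMonoidAlgebra R (ι → ℤ)) := by
  let := (ofMvPolynomial R ι).toAlgebra
  have := isLocalization_ofMvPolynomial R ι
  exact UniqueFactorizationMonoid.of_isLocalization (M := MvPolynomial ι R)
    (S := monomials R ι) _

end UFD

end AddMonoidAlgebra

/-! ### Factorization in ordered groups with a chain condition below 1. -/

section OrderedGroup

variable {G : Type*} [CommGroup G] [PartialOrder G]

theorem exists_le_covBy_one [WellFoundedGT (Set.Iic (1 : G))] {I : G} (hI : I < 1) :
    ∃ Q, I ≤ Q ∧ Q ⋖ 1 := by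
  obtain ⟨Q, ⟨hIQ, hQ⟩, hmax⟩ := WellFounded.has_min
    (wellFounded_gt (α := Set.Iic (1 : G))) {J | I ≤ J.1 ∧ J.1 < 1} ⟨⟨I, hI.le⟩, le_rfl, hI⟩
  refine ⟨Q.1, hIQ, hQ, fun J hQJ hJ => hmax ⟨J, hJ.le⟩ ⟨hIQ.trans hQJ.le, hJ⟩ hQJ⟩

variable [IsOrderedMonoid G]

theorem mem_closure_covBy_one [WellFoundedGT (Set.Iic (1 : G))] {I : G} (hI : I ≤ 1) :
    I ∈ Submonoid.closure {Q : G | Q ⋖ 1} := by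
  suffices h : ∀ I : Set.Iic (1 : G), I.1 ∈ Submonoid.closure {Q : G | Q ⋖ 1} from h ⟨I, hI⟩
  intro I
  induction I using WellFoundedGT.induction with
  | ind I ih =>
    obtain h | h := I.2.eq_or_lt
    · rw [h]
      exact one_mem _
    · obtain ⟨Q, hIQ, hQ⟩ := exists_le_covBy_one h
      -- Dividing by Q stays integral and strictly enlarges I, so Noetherian induction applies.
      have h1 : I.1 * Q⁻¹ ≤ 1 := by simpa using hIQ
      have h2 : I.1 < I.1 * Q⁻¹ := by simpa using hQ.lt
      rw [← inv_mul_cancel_right I.1 Q]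
      exact mul_mem (ih ⟨_, h1⟩ h2) (Submonoid.subset_closure hQ)

theorem le_one_of_mem_closure_covBy_one {I : G} (hI : I ∈ Submonoid.closure {Q : G | Q ⋖ 1}) :
    I ≤ 1 := by
  induction hI using Submonoid.closure_induction with
  | mem Q hQ => exact hQ.le
  | one => exact le_rfl
  | mul I J _ _ hI hJ => exact mul_le_one' hI hJ

end OrderedGroup

/-! ### Divisorial ideals as an ordered group; conductors. -/

namespace DivisorialFractionalIdeal

section Domain

variable {A : Type*} [CommRing A] [IsDomain A]

instance : PartialOrder (DivisorialFractionalIdeal A) :=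
  PartialOrder.lift val fun _ _ h => DivisorialFractionalIdeal.ext h

theorem le_def {I J : DivisorialFractionalIdeal A} : I ≤ J ↔ I.val ≤ J.val := Iff.rfl

theorem divisorialClosure_mono {I J : FractionalIdeal A⁰ (FractionRing A)} (hI : I ≠ 0)
    (hJ : J ≠ 0) (h : I ≤ J) : divisorialClosure I ≤ divisorialClosure J :=
  inv_anti_mono (inv_ne_zero_of_ne_zero hJ) (inv_ne_zero_of_ne_zero hI) (inv_anti_mono hI hJ h)

theorem mul_mem_val_mul {I J : DivisorialFractionalIdeal A} {a b : FractionRing A}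
    (ha : a ∈ I.val) (hb : b ∈ J.val) : a * b ∈ (I * J).val :=
  le_divisorialClosure (mul_ne_zero_of_ne_zero I.ne_zero J.ne_zero) (mul_mem_mul ha hb)

/-- The ideal of the elements of `A` that lie in a divisorial fractional ideal. -/
def toIdeal (I : DivisorialFractionalIdeal A) : Ideal A :=
  Submodule.comap (Algebra.linearMap A (FractionRing A)) I.val

theorem mem_toIdeal {I : DivisorialFractionalIdeal A} {a : A} :
    a ∈ I.toIdeal ↔ algebraMap A (FractionRing A) a ∈ I.val := Iff.rfl

theorem coeIdeal_toIdeal {I : DivisorialFractionalIdeal A} (hI : I ≤ 1) :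
    (I.toIdeal : FractionalIdeal A⁰ (FractionRing A)) = I.val := by
  ext y
  rw [mem_coeIdeal]
  refine ⟨fun ⟨a, ha, h⟩ => h ▸ ha, fun hy => ?_⟩
  obtain ⟨a, rfl⟩ := (mem_one_iff A⁰).1 (hI hy)
  exact ⟨a, hy, rfl⟩

theorem toIdeal_one : (1 : DivisorialFractionalIdeal A).toIdeal = ⊤ :=
  (Ideal.eq_top_iff_one _).2 ((mem_one_iff A⁰).2 ⟨1, rfl⟩)

theorem toIdeal_mono {I J : DivisorialFractionalIdeal A} (h : I ≤ J) : I.toIdeal ≤ J.toIdeal :=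
  fun _ ha => h ha

theorem toIdeal_le_iff {I J : DivisorialFractionalIdeal A} (hI : I ≤ 1) :
    I.toIdeal ≤ J.toIdeal ↔ I ≤ J := by
  refine ⟨fun h y hy => ?_, toIdeal_mono⟩
  obtain ⟨a, rfl⟩ := (mem_one_iff A⁰).1 (hI hy)
  exact h hy

theorem toIdeal_mul_le (I J : DivisorialFractionalIdeal A) :
    I.toIdeal * J.toIdeal ≤ (I * J).toIdeal := by
  refine Ideal.mul_le.2 fun a ha b hb => ?_
  rw [mem_toIdeal, map_mul]
  exact mul_mem_val_mul ha hb

theorem toIdeal_eq_top_iff {I : DivisorialFractionalIdeal A} (hI : I ≤ 1) :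
    I.toIdeal = ⊤ ↔ I = 1 := by
  refine ⟨fun h => le_antisymm hI ?_, fun h => h ▸ toIdeal_one⟩
  rw [← toIdeal_le_iff le_rfl, h]
  exact le_top

theorem toIdeal_ne_bot (I : DivisorialFractionalIdeal A) : I.toIdeal ≠ ⊥ := by
  obtain ⟨y, hy, hy0⟩ : ∃ y ∈ I.val, y ≠ 0 := by
    by_contra! h
    exact I.ne_zero (eq_zero_iff.2 h)
  obtain ⟨a, s, hs, rfl⟩ := IsFractionRing.div_surjective (A := A) y
  intro hbot
  have hs0 : algebraMap A (FractionRing A) s ≠ 0 := by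
    simpa using nonZeroDivisors.ne_zero hs
  have ha : a ∈ I.toIdeal := by
    rw [mem_toIdeal]
    have h : s • (algebraMap A (FractionRing A) a / algebraMap A (FractionRing A) s) ∈
      I.val := Submodule.smul_mem (I.val : Submodule A (FractionRing A)) s hy
    rwa [Algebra.smul_def, mul_div_cancel₀ _ hs0] at h
  rw [hbot, Ideal.mem_bot] at ha
  simp [ha] at hy0

/-- The conductor `{a ∈ A | a y ∈ A}` of an element `y` of the quotient field. -/
noncomputable def conductor (y : FractionRing A) : DivisorialFractionalIdeal A where
  -- Written as the inverse of A + yA, the conductor is divisorial for free.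
  val := (1 + spanSingleton A⁰ y)⁻¹
  ne_zero := inv_ne_zero_of_ne_zero (ne_of_gt (lt_of_lt_of_le zero_lt_one (le_self_add)))
  isDivisorial := isDivisorial_inv (ne_of_gt (lt_of_lt_of_le zero_lt_one (le_self_add)))

theorem mem_conductor {x y : FractionRing A} :
    x ∈ (conductor y).val ↔ x ∈ (1 : FractionalIdeal A⁰ (FractionRing A)) ∧
      x * y ∈ (1 : FractionalIdeal A⁰ (FractionRing A)) := by
  have h0 : (1 + spanSingleton A⁰ y) ≠ 0 :=
    ne_of_gt (lt_of_lt_of_le zero_lt_one (le_self_add))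
  rw [← spanSingleton_le_iff_mem (I := (conductor y).val), conductor,
    le_inv_iff_mul_le_one h0, mul_add, mul_one, spanSingleton_mul_spanSingleton,
    ← sup_eq_add, sup_le_iff, spanSingleton_le_iff_mem, spanSingleton_le_iff_mem]

theorem conductor_le_one (y : FractionRing A) : conductor y ≤ 1 :=
  fun _ hx => (mem_conductor.1 hx).1

theorem conductor_eq_one_iff {y : FractionRing A} :
    conductor y = 1 ↔ y ∈ (1 : FractionalIdeal A⁰ (FractionRing A)) := by
  refine ⟨fun h => ?_, fun h => le_antisymm (conductor_le_one y) fun x hx => ?_⟩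
  · have h1 : (1 : FractionRing A) ∈ (conductor y).val := by
      rw [h]
      exact one_mem_one A⁰
    simpa using (mem_conductor.1 h1).2
  · refine mem_conductor.2 ⟨hx, ?_⟩
    have := mul_mem_mul (I := (1 : FractionalIdeal A⁰ (FractionRing A))) hx h
    rwa [one_mul] at this

theorem eq_of_toIdeal_le {Q R : DivisorialFractionalIdeal A} (hQ : Q ⋖ 1) (hR : R ⋖ 1)
    (h : Q.toIdeal ≤ R.toIdeal) : Q = R :=
  ((hQ.eq_or_eq ((toIdeal_le_iff hQ.le).1 h) hR.le).resolve_right hR.ne).symm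

end Domain

/-! ### Height-one primes of a Krull domain are the elements covered by 1. -/

variable {A : Type*} [CommRing A] [IsDomain A] [IsKrullDomain A]

instance : IsOrderedMonoid (DivisorialFractionalIdeal A) where
  mul_le_mul_left I J h L :=
    divisorialClosure_mono (mul_ne_zero_of_ne_zero I.ne_zero L.ne_zero)
      (mul_ne_zero_of_ne_zero J.ne_zero L.ne_zero) (_root_.mul_le_mul_left (le_def.1 h) L.val)

instance : WellFoundedGT (Set.Iic (1 : DivisorialFractionalIdeal A)) := by
  have := IsKrullDomain.wellFoundedGT_divisorial (A := A)
  let f : Set.Iic (1 : DivisorialFractionalIdeal A) →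
      {I : Ideal A // IsDivisorial (I : FractionalIdeal A⁰ (FractionRing A))} :=
    fun I => ⟨I.1.toIdeal, by rw [coeIdeal_toIdeal I.2]; exact I.1.isDivisorial⟩
  have hf : StrictMono f := by
    intro I J h
    refine lt_of_le_of_ne (toIdeal_mono h.le) fun he => h.not_ge ?_
    exact (toIdeal_le_iff J.2).1 (congrArg Subtype.val he).ge
  exact hf.wellFoundedGT

theorem mul_mem_one_of_mem_inv {I : DivisorialFractionalIdeal A} {a b : FractionRing A}
    (ha : a ∈ I.val) (hb : b ∈ (I⁻¹).val) :
    a * b ∈ (1 : FractionalIdeal A⁰ (FractionRing A)) := by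
  have := mul_mem_val_mul ha hb
  rwa [mul_inv_cancel, val_one] at this

/-- Q < 1 makes Q⁻¹ contain some y outside A. The conductor of y is proper and contains Q, so
maximality forces equality. -/
theorem exists_mem_inv_eq_conductor {Q : DivisorialFractionalIdeal A} (hQ : Q ⋖ 1) :
    ∃ y ∈ (Q⁻¹).val, Q = conductor y := by
  have h1 : ¬ Q⁻¹ ≤ 1 := by simpa using hQ.lt.not_ge
  rw [le_def] at h1
  obtain ⟨y, hy, hy1⟩ := SetLike.not_le_iff_exists.1 h1
  refine ⟨y, hy, ?_⟩
  have hle : Q ≤ conductor y := fun x hx =>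
    mem_conductor.2 ⟨hQ.le hx, mul_mem_one_of_mem_inv hx hy⟩
  exact ((hQ.eq_or_eq hle (conductor_le_one y)).resolve_right
    fun h => hy1 (conductor_eq_one_iff.1 h)).symm

/-- For a outside the conductor of y, the conductor of ay is still proper and contains that of y. By
maximality they agree, and aby ∈ A says that b lies in the conductor of ay. -/
theorem isPrime_toIdeal {Q : DivisorialFractionalIdeal A} (hQ : Q ⋖ 1) : Q.toIdeal.IsPrime := by
  obtain ⟨y, -, rfl⟩ := exists_mem_inv_eq_conductor hQ
  refine ⟨fun h => hQ.ne ((toIdeal_eq_top_iff hQ.le).1 h), fun {a b} hab => ?_⟩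
  by_contra! h
  have ha : algebraMap A (FractionRing A) a * y ∉ (1 : FractionalIdeal A⁰ (FractionRing A)) :=
    fun hay => h.1 (mem_conductor.2 ⟨coe_mem_one A⁰ a, hay⟩)
  have hle : conductor y ≤ conductor (algebraMap A (FractionRing A) a * y) := fun x hx => by
    obtain ⟨h1, h2⟩ := mem_conductor.1 hx
    refine mem_conductor.2 ⟨h1, ?_⟩
    have := mul_mem_mul (coe_mem_one A⁰ (P := FractionRing A) a) h2
    rw [one_mul] at this
    convert this using 1
    ring
  have heq := (hQ.eq_or_eq hle (conductor_le_one _)).resolve_right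
    fun h => ha (conductor_eq_one_iff.1 h)
  refine h.2 ?_
  rw [← heq]
  refine mem_conductor.2 ⟨coe_mem_one A⁰ b, ?_⟩
  have := (mem_conductor.1 (mem_toIdeal.1 hab)).2
  convert this using 1
  rw [map_mul, Algebra.linearMap_apply]
  ring

theorem exists_covBy_one_toIdeal_le {I : DivisorialFractionalIdeal A} (hI : I ≤ 1)
    {p : Ideal A} (hp : p.IsPrime) (h : I.toIdeal ≤ p) :
    ∃ Q : DivisorialFractionalIdeal A, Q ⋖ 1 ∧ Q.toIdeal ≤ p := by
  have hmem := mem_closure_covBy_one hI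
  clear hI
  induction hmem using Submonoid.closure_induction with
  | mem Q hQ => exact ⟨Q, hQ, h⟩
  | one =>
    rw [toIdeal_one] at h
    exact absurd (top_le_iff.1 h) hp.ne_top
  | mul I J _ _ hI hJ =>
    exact (hp.mul_le.1 ((toIdeal_mul_le I J).trans h)).elim hI hJ

/-- The principal fractional ideal generated by a nonzero element of `A`. -/
noncomputable def principalOf {a : A} (ha : a ≠ 0) : DivisorialFractionalIdeal A :=
  principal A (Units.mk0 (algebraMap A (FractionRing A) a) (by simpa using ha))

theorem val_principal (x : (FractionRing A)ˣ) :
    (principal A x).val = spanSingleton A⁰ (x : FractionRing A) := rfl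

theorem principal_le_iff {x : (FractionRing A)ˣ} {I : DivisorialFractionalIdeal A} :
    principal A x ≤ I ↔ (x : FractionRing A) ∈ I.val :=
  spanSingleton_le_iff_mem

theorem principalOf_le_iff {a : A} (ha : a ≠ 0) {I : DivisorialFractionalIdeal A} :
    principalOf ha ≤ I ↔ a ∈ I.toIdeal :=
  principal_le_iff

theorem principalOf_le_one {a : A} (ha : a ≠ 0) : principalOf ha ≤ 1 :=
  (principalOf_le_iff ha).2 (by rw [toIdeal_one]; trivial)

theorem principalOf_mul {a b : A} (ha : a ≠ 0) (hb : b ≠ 0) :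
    principalOf (mul_ne_zero ha hb) = principalOf ha * principalOf hb := by
  rw [principalOf, principalOf, principalOf, ← map_mul]
  congr 1
  ext
  simp

theorem principalOf_eq_one {a : A} (ha : IsUnit a) : principalOf ha.ne_zero = 1 := by
  refine le_antisymm (principalOf_le_one _) ?_
  rw [← toIdeal_le_iff le_rfl, toIdeal_one, top_le_iff]
  exact Ideal.eq_top_of_isUnit_mem _ ((principalOf_le_iff ha.ne_zero).1 le_rfl) ha

theorem exists_covBy_one_toIdeal_le_of_ne_bot {p : Ideal A} (hp : p.IsPrime) (h0 : p ≠ ⊥) :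
    ∃ Q : DivisorialFractionalIdeal A, Q ⋖ 1 ∧ Q.toIdeal ≤ p := by
  obtain ⟨a, ha, ha0⟩ := Submodule.exists_mem_ne_zero_of_ne_bot h0
  refine exists_covBy_one_toIdeal_le (principalOf_le_one ha0) hp fun b hb => ?_
  rw [mem_toIdeal, principalOf, val_principal, mem_spanSingleton] at hb
  obtain ⟨c, hc⟩ := hb
  rw [Units.val_mk0, Algebra.smul_def, ← map_mul] at hc
  rw [← IsFractionRing.injective A (FractionRing A) hc]
  exact p.mul_mem_left c ha

theorem height_toIdeal {Q : DivisorialFractionalIdeal A} (hQ : Q ⋖ 1) : Q.toIdeal.height = 1 := by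
  have := isPrime_toIdeal hQ
  refine le_antisymm ?_ ?_
  · refine Ideal.height_le_iff (n := 1).2 fun r hr hlt => ?_
    -- A nonzero prime contains an ideal covered by 1, and no such ideal lies strictly inside
    -- another.
    have hr0 : r = ⊥ := by
      by_contra h0
      obtain ⟨R, hR, hRr⟩ := exists_covBy_one_toIdeal_le_of_ne_bot hr h0
      have := eq_of_toIdeal_le hR hQ (hRr.trans hlt.le)
      subst this
      exact hlt.not_ge hRr
    rw [hr0, Ideal.height_bot]
    exact zero_lt_one
  · rw [Order.one_le_iff_ne_zero, Ne, Ideal.height_eq_zero_iff_eq_bot]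
    exact toIdeal_ne_bot Q

theorem exists_toIdeal_eq_of_height_eq_one {p : Ideal A} (hp : p.IsPrime) (h1 : p.height = 1) :
    ∃ Q : DivisorialFractionalIdeal A, Q ⋖ 1 ∧ Q.toIdeal = p := by
  obtain ⟨Q, hQ, hle⟩ := exists_covBy_one_toIdeal_le_of_ne_bot hp (Ideal.ne_bot_of_height_eq_one h1)
  refine ⟨Q, hQ, hle.eq_of_not_lt fun hlt => ?_⟩
  have := isPrime_toIdeal hQ
  have : Q.toIdeal.FiniteHeight := ⟨Or.inr (by rw [height_toIdeal hQ]; exact ENat.one_ne_top)⟩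
  have := Ideal.height_strict_mono_of_isPrime hlt
  rw [height_toIdeal hQ, h1] at this
  exact lt_irrefl _ this

end DivisorialFractionalIdeal

/-! ### What the Laurent hypothesis says about the localization. -/

namespace IsLaurentLocalization

variable {A : Type*} [CommRing A] [IsDomain A] {n : ℕ} {x : Fin n → A} {D : Subring A}

theorem closure_le_nonZeroDivisors (h : IsLaurentLocalization D x) :
    Submonoid.closure (Set.range x) ≤ A⁰ := by
  obtain ⟨e, -, -⟩ := h
  have := e.injective.nontrivial
  intro s hs
  rw [mem_nonZeroDivisors_iff_ne_zero]
  rintro rfl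
  have h0 := IsLocalization.map_units (Localization (Submonoid.closure (Set.range x)))
    (⟨0, hs⟩ : Submonoid.closure (Set.range x))
  rw [map_zero] at h0
  exact not_isUnit_zero h0

theorem uniqueFactorizationMonoid [UniqueFactorizationMonoid D] (h : IsLaurentLocalization D x) :
    UniqueFactorizationMonoid (Localization (Submonoid.closure (Set.range x))) := by
  obtain ⟨e, -, -⟩ := h
  have := e.injective.nontrivial
  have := AddMonoidAlgebra.uniqueFactorizationMonoid_laurent D (Fin n)
  exact e.toMulEquiv.uniqueFactorizationMonoid this

theorem _root_.AddMonoidAlgebra.single_natCast_eq_prod {R ι : Type*} [CommRing R] [Fintype ι]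
    [DecidableEq ι] (k : ι → ℕ) :
    (AddMonoidAlgebra.single (fun i => (k i : ℤ)) 1 : AddMonoidAlgebra R (ι → ℤ)) =
      ∏ i, AddMonoidAlgebra.single (Pi.single i 1) 1 ^ k i := by
  have h : Multiplicative.ofAdd (fun i => (k i : ℤ)) =
      ∏ i, Multiplicative.ofAdd (Pi.single i 1 : ι → ℤ) ^ k i := by
    apply Multiplicative.toAdd.injective
    rw [toAdd_prod]
    ext j
    simp [Finset.sum_apply, Pi.single_apply]
  have := congrArg (AddMonoidAlgebra.of R (ι → ℤ)) h
  rw [map_prod] at this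
  simpa only [map_pow, AddMonoidAlgebra.of_apply, toAdd_ofAdd] using this

/-- An element of `A` that becomes a unit in the localization is, up to monomials, a unit. -/
theorem exists_mul_prod_eq (h : IsLaurentLocalization D x) {u : A}
    (hu : IsUnit (algebraMap A (Localization (Submonoid.closure (Set.range x))) u)) :
    ∃ (d : A) (k l : Fin n → ℕ), IsUnit d ∧ u * ∏ i, x i ^ k i = d * ∏ i, x i ^ l i := by
  have hinj := IsLocalization.injective (Localization (Submonoid.closure (Set.range x)))
    h.closure_le_nonZeroDivisors
  obtain ⟨e, heD, hex⟩ := h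
  obtain ⟨m, d, hd, hm⟩ := AddMonoidAlgebra.exists_eq_single_of_isUnit (hu.map e.symm)
  have hmon : ∀ k : Fin n → ℕ, e (AddMonoidAlgebra.single (fun i => (k i : ℤ)) 1) =
      algebraMap A _ (∏ i, x i ^ k i) := by
    intro k
    rw [AddMonoidAlgebra.single_natCast_eq_prod, map_prod, map_prod]
    exact Finset.prod_congr rfl fun i _ => by rw [map_pow, hex, map_pow]
  -- The unit is d x^m with d a unit of `D`; moving the negative part of m to the other side gives
  -- an identity inside `A`.
  refine ⟨d, fun i => (-m i).toNat, fun i => (m i).toNat, hd.map D.subtype, hinj ?_⟩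
  rw [map_mul, map_mul, ← hmon, ← hmon, ← heD, (e.symm_apply_eq.1 hm), ← map_mul, ← map_mul,
    AddMonoidAlgebra.single_mul_single, AddMonoidAlgebra.single_mul_single, zero_add]
  congr 2
  ext i
  simp only [Pi.add_apply]
  omega

end IsLaurentLocalization

/-! ### Nagata's theorem and independence of the primes. -/

namespace DivisorialFractionalIdeal

section Domain

variable {A : Type*} [CommRing A] [IsDomain A]

/-- Here y = u/π. Divisibility in the localization means us = πc with s ∈ S, hence sy = c ∈ A,
putting s in the conductor. -/
theorem not_dvd_of_conductor {S : Submonoid A} (hS : S ≤ A⁰) {π u : A} (hπ : π ≠ 0)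
    {y : FractionRing A}
    (hu : algebraMap A (FractionRing A) u = algebraMap A (FractionRing A) π * y)
    (hy : ∀ s ∈ S, s ∉ (conductor y).toIdeal) :
    ¬ algebraMap A (Localization S) π ∣ algebraMap A (Localization S) u := by
  rintro ⟨b, hb⟩
  obtain ⟨⟨c, s⟩, hc⟩ := IsLocalization.surj S b
  have h1 : u * s = π * c := by
    apply IsLocalization.injective (Localization S) hS
    rw [map_mul, map_mul, hb, mul_assoc, hc]
  have hπ' : algebraMap A (FractionRing A) π ≠ 0 := by simpa using hπ
  refine hy s s.2 (mem_conductor.2 ⟨coe_mem_one A⁰ _, (mem_one_iff A⁰).2 ⟨c, ?_⟩⟩)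
  apply mul_left_cancel₀ hπ'
  rw [← map_mul, ← h1, map_mul, hu, Algebra.linearMap_apply]
  ring

end Domain

variable {A : Type*} [CommRing A] [IsDomain A] [IsKrullDomain A]

/-- A prime of the localization has at most one prime divisor disjoint from S, with multiplicity one
(Q = R is allowed). Write Q and R as conductors of y and z. If π ∈ QR then πy, πz and πyz lie in A,
and (πy)(πz) = π(πyz) forces π to divide πy or πz in the localization. -/
theorem not_principalOf_le_mul {S : Submonoid A} (hS : S ≤ A⁰) {π : A} (hπ0 : π ≠ 0)
    (hπ : Prime (algebraMap A (Localization S) π)) {Q R : DivisorialFractionalIdeal A}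
    (hQ : Q ⋖ 1) (hR : R ⋖ 1) (hQS : ∀ s ∈ S, s ∉ Q.toIdeal) (hRS : ∀ s ∈ S, s ∉ R.toIdeal) :
    ¬ principalOf hπ0 ≤ Q * R := by
  intro hle
  obtain ⟨y, hy, hQy⟩ := exists_mem_inv_eq_conductor hQ
  obtain ⟨z, hz, hRz⟩ := exists_mem_inv_eq_conductor hR
  have hQR := (principalOf_le_iff hπ0).1 hle
  obtain ⟨u, hu⟩ := (mem_one_iff A⁰).1 <| mul_mem_one_of_mem_inv
    (toIdeal_mono (mul_le_of_le_one_right' hR.le) hQR) hy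
  obtain ⟨v, hv⟩ := (mem_one_iff A⁰).1 <| mul_mem_one_of_mem_inv
    (toIdeal_mono (mul_le_of_le_one_left' hQ.le) hQR) hz
  have hyz : y * z ∈ ((Q * R)⁻¹).val := by
    rw [mul_inv]
    exact mul_mem_val_mul hy hz
  obtain ⟨w, hw⟩ := (mem_one_iff A⁰).1 <| mul_mem_one_of_mem_inv hQR hyz
  rw [Algebra.linearMap_apply] at hu hv hw
  have huv : u * v = π * w := by
    apply IsFractionRing.injective A (FractionRing A)
    rw [map_mul, map_mul, hu, hv, hw]
    ring
  have hdvd : algebraMap A (Localization S) π ∣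
      algebraMap A (Localization S) u * algebraMap A (Localization S) v := by
    rw [← map_mul, huv, map_mul]
    exact dvd_mul_right _ _
  rcases hπ.dvd_or_dvd hdvd with h | h
  · exact not_dvd_of_conductor hS hπ0 hu (hQy ▸ hQS) h
  · exact not_dvd_of_conductor hS hπ0 hv (hRz ▸ hRS) h

/-- If the localization of a Krull domain at `S` is factorial, its divisors are generated by
the principal ones and the height-one primes that meet `S`. -/
theorem eq_top_of_uniqueFactorizationMonoid_localization {S : Submonoid A} (hS : S ≤ A⁰)
    [UniqueFactorizationMonoid (Localization S)] (H : Subgroup (DivisorialFractionalIdeal A))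
    (hprin : (principal A).range ≤ H)
    (hH : ∀ Q : DivisorialFractionalIdeal A, Q ⋖ 1 → ∀ s ∈ S, s ∈ Q.toIdeal → Q ∈ H) :
    H = ⊤ := by
  -- An integral divisor none of whose prime factors is disjoint from S lies in H.
  have hmeet : ∀ J ∈ Submonoid.closure {Q : DivisorialFractionalIdeal A | Q ⋖ 1},
      (∀ R : DivisorialFractionalIdeal A, R ⋖ 1 → (∀ s ∈ S, s ∉ R.toIdeal) → ¬ J ≤ R) →
      J ∈ H := by
    intro J hJ
    induction hJ using Submonoid.closure_induction with
    | mem Q hQ =>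
      intro h
      by_contra hQH
      exact h Q hQ (fun s hs hsQ => hQH (hH Q hQ s hs hsQ)) le_rfl
    | one => exact fun _ => one_mem _
    | mul I J hI hJ ihI ihJ =>
      intro h
      refine mul_mem (ihI fun R hR hRS hle => h R hR hRS ?_)
        (ihJ fun R hR hRS hle => h R hR hRS ?_)
      · exact (mul_le_of_le_one_right' (le_one_of_mem_closure_covBy_one hJ)).trans hle
      · exact (mul_le_of_le_one_left' (le_one_of_mem_closure_covBy_one hI)).trans hle
  have hprime : ∀ Q : DivisorialFractionalIdeal A, Q ⋖ 1 → Q ∈ H := by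
    intro Q hQ
    by_cases hQS : ∃ s ∈ S, s ∈ Q.toIdeal
    · obtain ⟨s, hs, hsQ⟩ := hQS
      exact hH Q hQ s hs hsQ
    push Not at hQS
    have hdisj : Disjoint (S : Set A) Q.toIdeal := Set.disjoint_left.2 hQS
    have hP := IsLocalization.isPrime_of_isPrime_disjoint S (Localization S) _
      (isPrime_toIdeal hQ) hdisj
    have hinj := IsLocalization.injective (Localization S) hS
    have hP0 : Q.toIdeal.map (algebraMap A (Localization S)) ≠ ⊥ :=
      (Ideal.map_eq_bot_iff_of_injective hinj).not.2 (toIdeal_ne_bot Q)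
    obtain ⟨ρ, hρQ, hρ⟩ := hP.exists_mem_prime_of_ne_bot hP0
    obtain ⟨⟨π, s⟩, hπs⟩ := IsLocalization.surj S ρ
    have hsu := IsLocalization.map_units (Localization S) s
    have hπ : Prime (algebraMap A (Localization S) π) := by
      rw [← hπs]
      exact (associated_mul_unit_right ρ _ hsu).prime hρ
    have hπQ : π ∈ Q.toIdeal := by
      rw [← IsLocalization.under_map_of_isPrime_disjoint S (Localization S)
        (isPrime_toIdeal hQ) hdisj, Ideal.mem_comap, ← hπs]
      exact Ideal.mul_mem_right _ _ hρQ
    have hπ0 : π ≠ 0 := by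
      rintro rfl
      exact hπ.ne_zero (map_zero _)
    -- The cofactor J = Q⁻¹(π) is integral, and a factor R of J disjoint from S would give (π) ≤ QR.
    have hle : Q⁻¹ * principalOf hπ0 ≤ 1 := by
      simpa using (principalOf_le_iff hπ0).2 hπQ
    have hJ := hmeet _ (mem_closure_covBy_one hle) fun R hR hRS hJR => by
      refine not_principalOf_le_mul hS hπ0 hπ hQ hR hQS hRS ?_
      rwa [inv_mul_le_iff_le_mul] at hJR
    exact inv_mem_iff.1 ((H.mul_mem_cancel_right (hprin ⟨_, rfl⟩)).1 hJ)
  have hint : ∀ I : DivisorialFractionalIdeal A, I ≤ 1 → I ∈ H := fun I hI =>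
    (Submonoid.closure_le (S := H.toSubmonoid)).2 hprime (mem_closure_covBy_one hI)
  refine (Subgroup.eq_top_iff' H).2 fun I => ?_
  -- A nonzero a ∈ A ∩ I⁻¹ clears denominators: aI is integral.
  obtain ⟨a, ha, ha0⟩ := Submodule.exists_mem_ne_zero_of_ne_bot (toIdeal_ne_bot I⁻¹)
  have h1 : I * principalOf ha0 ≤ 1 := by
    have := (principalOf_le_iff ha0).2 ha
    simpa using mul_le_mul_right this I
  exact (H.mul_mem_cancel_right (hprin ⟨_, rfl⟩)).1 (hint _ h1)

theorem exists_le_of_prod_le {ι : Type*} {s : Finset ι} {P : ι → DivisorialFractionalIdeal A}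
    {Q : DivisorialFractionalIdeal A} (hQ : Q ⋖ 1) (k : ι → ℕ)
    (h : ∏ j ∈ s, P j ^ k j ≤ Q) : ∃ j ∈ s, k j ≠ 0 ∧ (P j).toIdeal ≤ Q.toIdeal := by
  have hp := isPrime_toIdeal hQ
  have hpow : ∀ (I : DivisorialFractionalIdeal A) (m : ℕ), I.toIdeal ^ m ≤ (I ^ m).toIdeal := by
    intro I m
    induction m with
    | zero => rw [pow_zero, pow_zero, toIdeal_one]; exact le_top
    | succ m ih =>
      rw [pow_succ, pow_succ]
      exact (Ideal.mul_mono_left ih).trans (toIdeal_mul_le _ _)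
  have hprod : ∏ j ∈ s, (P j).toIdeal ^ k j ≤ (∏ j ∈ s, P j ^ k j).toIdeal := by
    clear h
    induction s using Finset.cons_induction with
    | empty => rw [Finset.prod_empty, Finset.prod_empty, toIdeal_one]; exact le_top
    | cons j s hj ih =>
      rw [Finset.prod_cons, Finset.prod_cons]
      exact (Ideal.mul_mono (hpow _ _) ih).trans (toIdeal_mul_le _ _)
  obtain ⟨j, hj, hle⟩ := hp.prod_le.1 (hprod.trans (toIdeal_mono h))
  have hk : k j ≠ 0 := by
    intro h0
    rw [h0, pow_zero, Ideal.one_eq_top] at hle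
    exact hp.ne_top (top_le_iff.1 hle)
  exact ⟨j, hj, hk, hp.le_of_pow_le hle⟩

/-- The divisor `∏ P j ^ m j` as a homomorphism. -/
noncomputable def divisorOf {t : ℕ} (P : Fin t → DivisorialFractionalIdeal A) :
    (Fin t → ℤ) →+ Additive (DivisorialFractionalIdeal A) where
  toFun m := Additive.ofMul (∏ j, P j ^ m j)
  map_zero' := by simp
  map_add' m m' := by simp [zpow_add, Finset.prod_mul_distrib]

theorem divisorOf_apply {t : ℕ} (P : Fin t → DivisorialFractionalIdeal A) (m : Fin t → ℤ) :
    divisorOf P m = Additive.ofMul (∏ j, P j ^ m j) := rfl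

/-- In a relation ∏ P_j^{m_j} = 1, separate positive and negative exponents. If m_i > 0, the
positive side lies in P_i, hence so does the negative side. Thus some P_j with m_j < 0 lies in P_i,
forcing j = i. -/
theorem divisorOf_injective {t : ℕ} {P : Fin t → DivisorialFractionalIdeal A}
    (hP : ∀ j, P j ⋖ 1) (hinj : Function.Injective P) : Function.Injective (divisorOf P) := by
  have key : ∀ m : Fin t → ℤ, divisorOf P m = 0 → ∀ j, m j ≤ 0 := by
    intro m hm i
    by_contra! hi
    have hle : ∏ j, P j ^ (-m j).toNat ≤ P i := by
      have h1 : ∏ j, P j ^ (m j).toNat = ∏ j, P j ^ (-m j).toNat := by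
        rw [← div_eq_one, ← Finset.prod_div_distrib, ← Additive.ofMul.injective.eq_iff,
          ofMul_one, ← hm, divisorOf_apply]
        congr 1
        refine Finset.prod_congr rfl fun j _ => ?_
        rw [← zpow_natCast, ← zpow_natCast, div_eq_mul_inv, ← zpow_sub]
        congr 1
        omega
      rw [← h1, ← Finset.mul_prod_erase _ _ (Finset.mem_univ i)]
      refine (mul_le_of_le_one_right' (Finset.prod_le_one' fun j _ =>
        pow_le_one' (hP j).le _)).trans ?_
      obtain ⟨k, hk⟩ := Nat.exists_eq_succ_of_ne_zero (n := (m i).toNat) (by omega)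
      rw [hk, pow_succ]
      exact mul_le_of_le_one_left' (pow_le_one' (hP i).le k)
    obtain ⟨j, -, hj, hji⟩ := exists_le_of_prod_le (hP i) _ hle
    have := hinj (eq_of_toIdeal_le (hP j) (hP i) hji)
    subst this
    omega
  refine (injective_iff_map_eq_zero _).2 fun m hm => ?_
  ext j
  refine le_antisymm (key m hm j) ?_
  have := key (-m) (by rw [map_neg, hm, neg_zero]) j
  simpa using this

end DivisorialFractionalIdeal

/-! ### Principal divisors supported on primes meeting S. -/

namespace DivisorialFractionalIdeal

variable {A : Type*} [CommRing A] [IsDomain A] [IsKrullDomain A]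

/-- Taking the closure once at the end agrees with taking it after every multiplication, by
`divisorialClosure_mul_left`. -/
theorem val_prod_pow {ι : Type*} (s : Finset ι) (P : ι → DivisorialFractionalIdeal A)
    (k : ι → ℕ) :
    (∏ j ∈ s, P j ^ k j).val = divisorialClosure (∏ j ∈ s, (P j).val ^ k j) := by
  let r : DivisorialFractionalIdeal A → FractionalIdeal A⁰ (FractionRing A) → Prop :=
    fun I J => J ≠ 0 ∧ I.val = divisorialClosure J
  have hone : r 1 1 := ⟨one_ne_zero, (1 : DivisorialFractionalIdeal A).isDivisorial.symm⟩
  have hmul : ∀ I I' J J', r I J → r I' J' → r (I * I') (J * J') := by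
    rintro I I' J J' ⟨hJ, hI⟩ ⟨hJ', hI'⟩
    refine ⟨mul_ne_zero_of_ne_zero hJ hJ', ?_⟩
    rw [val_mul, hI, hI', divisorialClosure_mul_left hJ (divisorialClosure_ne_zero hJ'),
      mul_comm J, divisorialClosure_mul_left hJ' hJ, mul_comm]
  have hpow : ∀ (I : DivisorialFractionalIdeal A) (m : ℕ), r (I ^ m) (I.val ^ m) := by
    intro I m
    induction m with
    | zero => simpa using hone
    | succ m ih =>
      rw [pow_succ, pow_succ]
      exact hmul _ _ _ _ ih ⟨I.ne_zero, I.isDivisorial.symm⟩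
  exact (Finset.prod_hom_rel (r := r) (s := s) (f := fun j => P j ^ k j)
    (g := fun j => (P j).val ^ k j) hone fun j b c h => hmul _ _ _ _ (hpow _ _) h).2

theorem principalOf_prod_pow_mem {ι : Type*} {x : ι → A} (hx : ∀ i, x i ≠ 0)
    {H : Subgroup (DivisorialFractionalIdeal A)} (hH : ∀ i, principalOf (hx i) ∈ H)
    (s : Finset ι) (k : ι → ℕ) (h0 : ∏ i ∈ s, x i ^ k i ≠ 0) : principalOf h0 ∈ H := by
  let T : Submonoid A :=
    { carrier := {a | ∃ ha : a ≠ 0, principalOf ha ∈ H}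
      one_mem' := ⟨one_ne_zero, by
        rw [principalOf_eq_one isUnit_one]
        exact one_mem _⟩
      mul_mem' := by
        rintro a b ⟨ha, haH⟩ ⟨hb, hbH⟩
        refine ⟨mul_ne_zero ha hb, ?_⟩
        rw [principalOf_mul ha hb]
        exact mul_mem haH hbH }
  have : ∏ i ∈ s, x i ^ k i ∈ T := prod_mem fun i _ =>
    pow_mem (show x i ∈ T from ⟨hx i, hH i⟩) _
  exact this.2

theorem principalOf_mem_of_isUnit {n : ℕ} {x : Fin n → A} {D : Subring A}
    (h : IsLaurentLocalization D x) (hx : ∀ i, x i ≠ 0)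
    {H : Subgroup (DivisorialFractionalIdeal A)} (hH : ∀ i, principalOf (hx i) ∈ H)
    {u : A} (hu0 : u ≠ 0)
    (hu : IsUnit (algebraMap A (Localization (Submonoid.closure (Set.range x))) u)) :
    principalOf hu0 ∈ H := by
  obtain ⟨d, k, l, hd, hkl⟩ := h.exists_mul_prod_eq hu
  have hprod : ∀ k : Fin n → ℕ, ∏ i, x i ^ k i ≠ 0 := fun k =>
    Finset.prod_ne_zero_iff.2 fun i _ => pow_ne_zero _ (hx i)
  have h1 : principalOf hu0 * principalOf (hprod k) =
      principalOf hd.ne_zero * principalOf (hprod l) := by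
    rw [← principalOf_mul, ← principalOf_mul]
    congr 1
  rw [principalOf_eq_one hd, one_mul] at h1
  refine (H.mul_mem_cancel_right (principalOf_prod_pow_mem hx hH _ k (hprod k))).1 ?_
  rw [h1]
  exact principalOf_prod_pow_mem hx hH _ l (hprod l)

/-- Positive powers contain powers of elements of S; inverses of integral divisors contain 1. -/
theorem exists_mem_prod_zpow {ι : Type*} [Fintype ι] {S : Submonoid A}
    {P : ι → DivisorialFractionalIdeal A} (hP : ∀ j, P j ≤ 1)
    (hPS : ∀ j, ∃ s ∈ S, s ∈ (P j).toIdeal) (m : ι → ℤ) :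
    ∃ s ∈ S, s ∈ (∏ j, P j ^ m j).toIdeal := by
  let T : Submonoid (DivisorialFractionalIdeal A) :=
    { carrier := {I | ∃ s ∈ S, s ∈ I.toIdeal}
      one_mem' := ⟨1, one_mem _, by rw [toIdeal_one]; trivial⟩
      mul_mem' := by
        rintro I J ⟨s, hs, hsI⟩ ⟨s', hs', hsJ⟩
        exact ⟨s * s', mul_mem hs hs', toIdeal_mul_le I J (Ideal.mul_mem_mul hsI hsJ)⟩ }
  have hinv : ∀ j, (P j)⁻¹ ∈ T := fun j => by
    refine ⟨1, one_mem _, ?_⟩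
    have h1 : (1 : DivisorialFractionalIdeal A) ≤ (P j)⁻¹ := by simpa using hP j
    refine toIdeal_mono h1 ?_
    rw [toIdeal_one]
    trivial
  have hz : ∀ j, P j ^ m j ∈ T := fun j => by
    obtain ⟨k, hk | hk⟩ := Int.eq_nat_or_neg (m j)
    · rw [hk, zpow_natCast]
      exact pow_mem (hPS j) k
    · rw [hk, zpow_neg, zpow_natCast, ← inv_pow]
      exact pow_mem (hinv j) k
  exact prod_mem fun j _ => hz j

/-- A principal divisor supported on primes meeting `S` comes from units of the localization. -/
theorem principal_mem_of_eq_prod {S : Submonoid A} (hS : S ≤ A⁰)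
    {H : Subgroup (DivisorialFractionalIdeal A)}
    (hH : ∀ (u : A) (hu0 : u ≠ 0), IsUnit (algebraMap A (Localization S) u) → principalOf hu0 ∈ H)
    {ι : Type*} [Fintype ι] {P : ι → DivisorialFractionalIdeal A} (hP : ∀ j, P j ≤ 1)
    (hPS : ∀ j, ∃ s ∈ S, s ∈ (P j).toIdeal) (m : ι → ℤ) {f : (FractionRing A)ˣ}
    (hf : principal A f = ∏ j, P j ^ m j) : principal A f ∈ H := by
  have hmem : ∀ (g : (FractionRing A)ˣ) (m : ι → ℤ), principal A g = ∏ j, P j ^ m j →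
      ∃ s ∈ S, ∃ a : A, algebraMap A (FractionRing A) a =
        g * algebraMap A (FractionRing A) s := by
    intro g m hg
    obtain ⟨s, hs, hsm⟩ := exists_mem_prod_zpow hP hPS (-m)
    have h1 : ∏ j, P j ^ (-m) j = (principal A g)⁻¹ := by
      rw [hg, ← Finset.prod_inv_distrib]
      exact Finset.prod_congr rfl fun j _ => by rw [Pi.neg_apply, zpow_neg]
    rw [h1] at hsm
    obtain ⟨a, ha⟩ := (mem_one_iff A⁰).1 (mul_mem_one_of_mem_inv
      (principal_le_iff.1 (le_refl (principal A g))) hsm)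
    exact ⟨s, hs, a, ha⟩
  obtain ⟨s, hs, a, ha⟩ := hmem f m hf
  obtain ⟨s', hs', b, hb⟩ := hmem f⁻¹ (-m) (by
    rw [map_inv, hf, ← Finset.prod_inv_distrib]
    exact Finset.prod_congr rfl fun j _ => by rw [Pi.neg_apply, zpow_neg])
  -- With a = fs and b = f⁻¹s', the product is in S, so a becomes a unit and f = a/s.
  have hab : a * b = s * s' := by
    apply IsFractionRing.injective A (FractionRing A)
    rw [map_mul, map_mul, ha, hb, mul_mul_mul_comm, Units.mul_inv, one_mul]
  have hsu : ∀ s ∈ S, IsUnit (algebraMap A (Localization S) s) := fun s hs =>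
    IsLocalization.map_units (Localization S) (⟨s, hs⟩ : S)
  have hau : IsUnit (algebraMap A (Localization S) a) := by
    refine isUnit_of_mul_isUnit_left (y := algebraMap A (Localization S) b) ?_
    rw [← map_mul, hab]
    exact hsu _ (mul_mem hs hs')
  have hs0 : s ≠ 0 := nonZeroDivisors.ne_zero (hS hs)
  have ha0 : a ≠ 0 := by
    rintro rfl
    rw [map_zero] at ha
    exact mul_ne_zero f.ne_zero (by simpa using hs0) ha.symm
  have hprin : principalOf ha0 = principal A f * principalOf hs0 := by
    rw [principalOf, principalOf, ← map_mul]
    congr 1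
    ext
    exact ha
  rw [← H.mul_mem_cancel_right (hH s hs0 (hsu s hs)), ← hprin]
  exact hH a ha0 hau

end DivisorialFractionalIdeal

/-! ### The class group. -/

open DivisorialFractionalIdeal in
theorem mainTheorem12 {A : Type*} [CommRing A] [IsDomain A] [IsKrullDomain A]
    {n t : ℕ} (x : Fin n → A) (D : Subring A) [UniqueFactorizationMonoid D]
    (hloc : IsLaurentLocalization D x)
    (p : Fin t → Ideal A) (hp_inj : Function.Injective p)
    (hp : ∀ q : Ideal A, q ∈ Set.range p ↔ q.IsPrime ∧ q.height = 1 ∧ ∃ i, x i ∈ q)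
    (a : Fin n → Fin t → ℕ)
    (ha : ∀ i, ((Ideal.span {x i} : Ideal A) : FractionalIdeal A⁰ (FractionRing A)) =
      FractionalIdeal.divisorialClosure
        (∏ j, ((p j : Ideal A) : FractionalIdeal A⁰ (FractionRing A)) ^ a i j)) :
    Nonempty (Additive (DivisorClassGroup A) ≃+
      (Fin t → ℤ) ⧸ AddSubgroup.closure (Set.range fun i : Fin n => fun j => (a i j : ℤ))) := by
  have hS := hloc.closure_le_nonZeroDivisors
  have := hloc.uniqueFactorizationMonoid
  have hxS : ∀ i, x i ∈ Submonoid.closure (Set.range x) := fun i =>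
    Submonoid.subset_closure ⟨i, rfl⟩
  have hx : ∀ i, x i ≠ 0 := fun i => nonZeroDivisors.ne_zero (hS (hxS i))
  have hpj := fun j => (hp (p j)).1 ⟨j, rfl⟩
  choose P hP hPp using fun j =>
    exists_toIdeal_eq_of_height_eq_one (hpj j).1 (hpj j).2.1
  have hPinj : Function.Injective P := fun i j h => hp_inj (by rw [← hPp, ← hPp, h])
  have hPS : ∀ j, ∃ s ∈ Submonoid.closure (Set.range x), s ∈ (P j).toIdeal := fun j => by
    obtain ⟨i, hi⟩ := (hpj j).2.2
    exact ⟨x i, hxS i, by rwa [hPp]⟩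
  have hX : ∀ i, principalOf (hx i) = ∏ j, P j ^ a i j := fun i => by
    refine DivisorialFractionalIdeal.ext ?_
    rw [val_prod_pow, principalOf, val_principal, Units.val_mk0, ← coeIdeal_span_singleton, ha]
    congr 1
    exact Finset.prod_congr rfl fun j _ => by rw [← coeIdeal_toIdeal (hP j).le, hPp]
  have hXd : ∀ i, divisorOf P (fun j => (a i j : ℤ)) = Additive.ofMul (principalOf (hx i)) := by
    intro i
    rw [hX, divisorOf_apply]
    simp only [zpow_natCast]
  let N := (principal A).range
  let φ : (Fin t → ℤ) →+ Additive (DivisorClassGroup A) :=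
    (QuotientGroup.mk' N).toAdditive.comp (divisorOf P)
  have hφ : ∀ m, φ m = 0 ↔ ∏ j, P j ^ m j ∈ N := fun m =>
    QuotientGroup.eq_one_iff (N := N) (∏ j, P j ^ m j)
  have hker : φ.ker = AddSubgroup.closure (Set.range fun i : Fin n => fun j => (a i j : ℤ)) := by
    refine le_antisymm (fun m hm => ?_) ((AddSubgroup.closure_le _).2 ?_)
    · obtain ⟨f, hf⟩ := (hφ m).1 hm
      -- H is the group generated by the divisors of the `x i`, realized as an image so that
      -- injectivity of `divisorOf P` returns membership to ℤ^t.
      let H : Subgroup (DivisorialFractionalIdeal A) := AddSubgroup.toSubgroup'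
        ((AddSubgroup.closure (Set.range fun i : Fin n => fun j => (a i j : ℤ))).map (divisorOf P))
      have hH : ∀ i, principalOf (hx i) ∈ H := fun i =>
        ⟨_, AddSubgroup.subset_closure ⟨i, rfl⟩, hXd i⟩
      have hfH : principal A f ∈ H := principal_mem_of_eq_prod hS
        (fun u hu0 hu => principalOf_mem_of_isUnit hloc hx hH hu0 hu)
        (fun j => (hP j).le) hPS m hf
      rw [hf] at hfH
      obtain ⟨m', hm', h⟩ := hfH
      rwa [divisorOf_injective hP hPinj h] at hm'
    · rintro _ ⟨i, rfl⟩
      refine (hφ _).2 ?_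
      simp only [zpow_natCast]
      rw [← hX]
      exact ⟨_, rfl⟩
  have hsurj : Function.Surjective φ := by
    have htop := eq_top_of_uniqueFactorizationMonoid_localization hS
      (AddSubgroup.toSubgroup' φ.range |>.comap (QuotientGroup.mk' N)) ?_ ?_
    · intro c
      obtain ⟨I, hI⟩ := QuotientGroup.mk'_surjective N c.toMul
      have h1 : I ∈ (AddSubgroup.toSubgroup' φ.range).comap (QuotientGroup.mk' N) :=
        htop ▸ Subgroup.mem_top I
      obtain ⟨m, hm⟩ := h1
      exact ⟨m, hm.trans hI⟩
    · intro I hI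
      exact ⟨0, φ.map_zero.trans ((QuotientGroup.eq_one_iff (N := N) I).2 hI).symm⟩
    · intro Q hQ s hs hsQ
      have hQp := isPrime_toIdeal hQ
      -- A prime meeting the monoid generated by the `x i` contains one of them, so Q is some P_j.
      obtain ⟨i, hi⟩ : ∃ i, x i ∈ Q.toIdeal := by
        by_contra! h
        have hle : Submonoid.closure (Set.range x) ≤ Q.toIdeal.primeCompl :=
          Submonoid.closure_le.2 (by rintro _ ⟨i, rfl⟩; exact h i)
        exact hle hs hsQ
      obtain ⟨j, hj⟩ := (hp Q.toIdeal).2 ⟨hQp, height_toIdeal hQ, i, hi⟩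
      have hQj : P j = Q := eq_of_toIdeal_le (hP j) hQ (by rw [hPp, hj])
      refine ⟨Pi.single j 1, ?_⟩
      have : divisorOf P (Pi.single j 1) = Additive.ofMul Q := by
        rw [divisorOf_apply, Finset.prod_eq_single j]
        · simp [hQj]
        · intro i _ hij
          simp [Pi.single_eq_of_ne hij]
        · simp
      exact congrArg (QuotientGroup.mk' N).toAdditive this
  exact ⟨((QuotientAddGroup.quotientAddEquivOfEq hker).symm.trans
    (QuotientAddGroup.quotientKerEquivOfSurjective φ hsurj)).symm⟩
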